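/- All graphs are finite and simple. A \emph{distinguishing coloring} of a graph $G$ is a partition of $V(G)$ into nonempty independent sets (the color classes) such that the identity is the only automorphism $f$ of $G$ satisfying $f(W)=W$ for every color class $W$. The \emph{distinguishing chromatic number} $\chi_D(G)$ is the minimum number of color classes in a distinguishing coloring of $G$, and $G$ is \emph{uniquely distinguishing colorable} if exactly one partition of $V(G)$ is a distinguishing coloring with $\chi_D(G)$ color classes. \textbf{Theorem.} Let $T$ be a finite tree that is uniquely distinguishing colorable and satisfies $\chi_D(T)\ge 3$. Then $T$ is a star graph, i.e. there is a vertex $r$ of $T$ such that the edges of $T$ are exactly the pairs $\{r,v\}$ with $v\in V(T)\setminus\{r\}$. -/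

import Mathlib

namespace SimpleGraph

variable {V : Type*} {G : SimpleGraph V}

/-- A proper coloring, given as a partition of the vertex set into nonempty independent color
classes (`SimpleGraph.Partition`), is *distinguishing* if the only automorphism `f` of the graph
with `f(s) = s` for every color class `s` is the identity. -/
def Partition.IsDistinguishing (P : G.Partition) : Prop :=
  ∀ f : G ≃g G, (∀ s ∈ P.parts, f '' s = s) → f = Iso.refl

/-- The distinguishing chromatic number of a graph: the least number of color classes of a
distinguishing (proper) coloring. -/
noncomputable def distinguishingChromaticNumber (G : SimpleGraph V) : ℕ∞ :=
  ⨅ (P : G.Partition) (_ : P.IsDistinguishing), P.parts.encard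

/-- A graph is uniquely distinguishing colorable if there is exactly one partition of its vertex
set that is a distinguishing (proper) coloring with the smallest possible number of classes. -/
def IsUniquelyDistinguishingColorable (G : SimpleGraph V) : Prop :=
  ∃! P : G.Partition, P.IsDistinguishing ∧ P.parts.encard = G.distinguishingChromaticNumber

end SimpleGraph

/-!
Let `T` be a finite tree that is uniquely distinguishing colorable with at least three classes.
Since two classes are not enough, the bipartition of `T` is preserved by an automorphism other than
the identity. It moves vertices by even distances, so it fixes a vertex (`exists_fixed_vertex`).
Hence some automorphism `f` fixes a vertex `v` and moves a neighbor `a` of `v`, so the branches `A`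
and `B` at `v` through `a` and `f a` are disjoint and isomorphic. If they are chosen of least size,
they have no automorphism that fixes their roots, apart from the identity (`exists_rigid_branch`).

By uniqueness, the exchange of `A` and `B` permutes the color classes of the given coloring, and it
moves at least one of them. A class that is moved has no vertex outside `A ∪ B`, so there are two
colors `i ≠ j` that occur only within `A ∪ B` (`exists_colors_in_branches`).

Suppose that `A` has more than one vertex. Choose `x` in `A`, give it the color `i`, and color the
rest of `A ∪ B` alternately with `j` and the color of `v`. An automorphism preserving this coloring
fixes `x`; by a count of vertices it fixes `v`, thus `A` pointwise, then `B` pointwise because of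
the color `j`, and so it preserves the original coloring (`eq_refl_of_recolorBranches`). Different
choices of `x` give different partitions, which contradicts uniqueness (`branch_eq_singleton`).

So `A` and `B` are leaves, and each of them is a class of its own. If a vertex `y ≠ v` were not
adjacent to `v`, it could be recolored with the color of the leaf `a`: the leaf `f a` is still the
only vertex of its color, so an automorphism preserving the new coloring fixes it and its neighbor
`v`, and then it cannot exchange `a` with `y`. This is again a second partition
(`adj_of_branch_eq_singleton`). Therefore every vertex is adjacent to `v`.
-/

namespace SimpleGraph

variable {V : Type*} {G : SimpleGraph V}

/-! ### Distances and branches in a tree -/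

lemma Iso.dist_apply (f : G ≃g G) (x y : V) : G.dist (f x) (f y) = G.dist x y := by
  have key : ∀ (g : G ≃g G) (x y : V), G.Reachable x y → G.dist (g x) (g y) ≤ G.dist x y := by
    intro g x y h
    obtain ⟨p, hp⟩ := h.exists_walk_length_eq_dist
    rw [← hp, ← Walk.length_map g.toHom p]
    exact dist_le _
  by_cases h : G.Reachable x y
  · refine le_antisymm (key f x y h) ?_
    simpa using key f.symm (f x) (f y) (f.reachable_iff.mpr h)
  · rw [dist_eq_zero_of_not_reachable h,
      dist_eq_zero_of_not_reachable (mt f.reachable_iff.mp h)]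

lemma Connected.exists_adj_dist_add_one (hG : G.Connected) {u w : V} (h : u ≠ w) :
    ∃ y, G.Adj u y ∧ G.dist y w + 1 = G.dist u w := by
  obtain ⟨p, hp⟩ := hG.exists_walk_length_eq_dist u w
  cases p with
  | nil => exact absurd rfl h
  | @cons _ y _ hadj q =>
    refine ⟨y, hadj, ?_⟩
    rw [Walk.length_cons] at hp
    have h1 := dist_le q
    have h2 := hG.dist_triangle (u := u) (v := y) (w := w)
    rw [dist_eq_one_iff_adj.mpr hadj] at h2
    omega

/-- For adjacent vertices `v` and `a` of a tree, the vertex set of the component of `a` in the tree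
with the edge `va` removed, described as the set of vertices that are closer to `a` than to `v`. -/
def branch (G : SimpleGraph V) (v a : V) : Set V := {x | G.dist a x < G.dist v x}

lemma mem_branch {v a x : V} : x ∈ G.branch v a ↔ G.dist a x < G.dist v x := Iff.rfl

lemma self_mem_branch {v a : V} (h : G.Adj v a) : a ∈ G.branch v a := by
  simp [mem_branch, dist_eq_one_iff_adj.mpr h]

lemma notMem_branch {v a : V} : v ∉ G.branch v a := by
  simp [mem_branch]

lemma Iso.apply_mem_branch (f : G ≃g G) {v a x : V} :
    f x ∈ G.branch (f v) (f a) ↔ x ∈ G.branch v a := by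
  simp only [mem_branch, f.dist_apply]

lemma Iso.apply_mem_branch_of_fixed (f : G ≃g G) {v a x : V} (hv : f v = v) :
    f x ∈ G.branch v (f a) ↔ x ∈ G.branch v a := by
  conv_lhs => rw [← hv]
  exact f.apply_mem_branch

namespace IsTree

variable (hT : G.IsTree)
include hT

lemma notMem_branch_iff {v a x : V} (h : G.Adj v a) :
    x ∉ G.branch v a ↔ x ∈ G.branch a v := by
  have := hT.dist_ne_of_adj x h
  rw [G.dist_comm (u := x), G.dist_comm (u := x)] at this
  simp only [mem_branch]
  omega

/-- An edge of a tree separates its two sides: a geodesic from one side to the other runs through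
the edge. -/
lemma dist_of_mem_branch {v a x w : V} (h : G.Adj v a) (hx : x ∉ G.branch v a)
    (hw : w ∈ G.branch v a) : G.dist x w = G.dist x v + 1 + G.dist a w := by
  classical
  rw [hT.notMem_branch_iff h] at hx
  rw [mem_branch] at hx hw
  obtain ⟨p, hp⟩ := hT.connected.exists_walk_length_eq_dist v x
  obtain ⟨q, hq⟩ := hT.connected.exists_walk_length_eq_dist a w
  obtain ⟨r, hr⟩ := hT.connected.exists_walk_length_eq_dist x w
  have hpa : a ∉ p.support := by
    intro ha
    have h1 := dist_le (p.dropUntil a ha)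
    have h2 := p.length_dropUntil_le_length ha
    omega
  have hqv : v ∉ q.support := by
    intro ha
    have h1 := dist_le (q.dropUntil v ha)
    have h2 := q.length_dropUntil_le_length ha
    omega
  have hbr := isBridge_iff_forall_walk_mem_edges.mp
    (isAcyclic_iff_forall_isBridge.mp hT.isAcyclic (e := s(v, a)) h)
      ((p.append r).append q.reverse)
  have hvr : v ∈ r.support := by
    simp only [Walk.edges_append, Walk.edges_reverse, List.mem_append, List.mem_reverse] at hbr
    rcases hbr with (hbr | hbr) | hbr
    · exact absurd (p.snd_mem_support_of_mem_edges hbr) hpa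
    · exact r.fst_mem_support_of_mem_edges hbr
    · exact absurd (q.fst_mem_support_of_mem_edges hbr) hqv
  have h1 := dist_le (r.takeUntil v hvr)
  have h2 := dist_le (r.dropUntil v hvr)
  have h3 : (r.takeUntil v hvr).length + (r.dropUntil v hvr).length = r.length := by
    rw [← Walk.length_append, Walk.take_spec]
  have h4 := hT.connected.dist_triangle (u := x) (v := v) (w := w)
  have h5 := hT.connected.dist_triangle (u := v) (v := a) (w := w)
  rw [dist_eq_one_iff_adj.mpr h] at h5
  omega

lemma eq_of_adj_of_mem_branch {v a x y : V} (h : G.Adj v a) (hxy : G.Adj x y)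
    (hx : x ∈ G.branch v a) (hy : y ∉ G.branch v a) : x = a ∧ y = v := by
  have h1 := hT.dist_of_mem_branch h hy hx
  rw [dist_eq_one_iff_adj.mpr hxy.symm] at h1
  have h2 : G.dist y v = 0 := by omega
  have h3 : G.dist a x = 0 := by omega
  exact ⟨(hT.connected.dist_eq_zero_iff.mp h3).symm, hT.connected.dist_eq_zero_iff.mp h2⟩

lemma eq_of_mem_branch_of_mem_branch {v a b x : V} (ha : G.Adj v a) (hb : G.Adj v b)
    (hxa : x ∈ G.branch v a) (hxb : x ∈ G.branch v b) : a = b := by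
  by_contra hne
  have hab : a ∉ G.branch v b := by
    intro h
    exact hne (hT.eq_of_adj_of_mem_branch hb ha.symm h notMem_branch).1
  have h1 := hT.dist_of_mem_branch hb hab hxb
  rw [dist_eq_one_iff_adj.mpr ha.symm] at h1
  have h2 := hT.connected.dist_triangle (u := v) (v := b) (w := x)
  rw [dist_eq_one_iff_adj.mpr hb] at h2
  rw [mem_branch] at hxa
  omega

lemma branch_subset_branch {v a u x : V} (hu : u ∈ G.branch v a)
    (hux : G.Adj u x) (hd : G.dist v u < G.dist v x) : G.branch u x ⊆ G.branch v a := by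
  intro y hy
  have hv : v ∉ G.branch u x := by
    rw [mem_branch, G.dist_comm (u := x), G.dist_comm (u := u)]
    omega
  have h1 := hT.dist_of_mem_branch hux hv hy
  have h2 := hT.connected.dist_triangle (u := a) (v := u) (w := y)
  have h3 := hT.connected.dist_triangle (u := u) (v := x) (w := y)
  rw [dist_eq_one_iff_adj.mpr hux] at h3
  rw [mem_branch] at hu ⊢
  omega

/-! ### Automorphisms of a tree -/

/-- An automorphism that preserves the bipartition of a finite tree has a fixed vertex. A vertex
with the least sum of distances to all vertices is moved by an even distance; moving it and
its image one step towards each other would lower the total of the two sums. -/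
lemma exists_fixed_vertex [Finite V] (f : G ≃g G) (hf : ∀ x, Even (G.dist x (f x))) :
    ∃ v, f v = v := by
  cases nonempty_fintype V
  have := hT.connected.nonempty
  let S : V → ℕ := fun v ↦ ∑ x, G.dist v x
  obtain ⟨u, hu⟩ := Finite.exists_min S
  refine ⟨u, ?_⟩
  by_contra hne
  set w := f u with hw
  obtain ⟨y, huy, hy⟩ := hT.connected.exists_adj_dist_add_one (Ne.symm hne)
  obtain ⟨z, hwz, hz⟩ := hT.connected.exists_adj_dist_add_one hne
  obtain ⟨m, hm⟩ := hf u
  rw [← hw] at hm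
  have hwy : w ∈ G.branch u y := by rw [mem_branch]; omega
  have huz : u ∈ G.branch w z := by rw [mem_branch]; omega
  have hSw : S w = S u := by
    simp only [S, hw]
    rw [← Equiv.sum_comp f.toEquiv]
    exact Finset.sum_congr rfl fun x _ ↦ f.dist_apply u x
  have hcomm := G.dist_comm (u := u) (v := w)
  have step : ∀ x, G.dist y x + G.dist z x ≤ G.dist u x + G.dist w x := by
    intro x
    by_cases hx : x ∈ G.branch u y
    · rw [mem_branch] at hx
      have h3 := hT.connected.dist_triangle (u := z) (v := w) (w := x)
      rw [dist_eq_one_iff_adj.mpr hwz.symm] at h3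
      omega
    · by_cases hx' : x ∈ G.branch w z
      · rw [mem_branch] at hx'
        have h3 := hT.connected.dist_triangle (u := y) (v := u) (w := x)
        rw [dist_eq_one_iff_adj.mpr huy.symm] at h3
        omega
      · have h1 := hT.dist_of_mem_branch huy hx hwy
        have h2 := hT.dist_of_mem_branch hwz hx' huz
        omega
  have strict : G.dist y y + G.dist z y < G.dist u y + G.dist w y := by
    have hy' : y ∈ G.branch w z := by
      by_contra hx'
      have h2 := hT.dist_of_mem_branch hwz hx' huz
      rw [dist_eq_one_iff_adj.mpr huy.symm] at h2
      have := G.dist_comm (u := w) (v := y)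
      omega
    rw [mem_branch] at hy'
    rw [dist_self]
    omega
  have hlt : S y + S z < S u + S w := by
    simp only [S, ← Finset.sum_add_distrib]
    exact Finset.sum_lt_sum (fun x _ ↦ step x) ⟨y, Finset.mem_univ _, strict⟩
  have := hu y
  have := hu z
  omega

/-- If two disjoint branches at `v` have the same size, an automorphism fixing a vertex of one of
them fixes `v`. Otherwise it would map the complement of the first branch, which is the larger
part, into that branch. -/
lemma apply_eq_of_branch [Finite V] {v a b x : V} (ha : G.Adj v a) (hb : G.Adj v b) (hab : a ≠ b)
    (hcard : (G.branch v b).ncard = (G.branch v a).ncard) (hx : x ∈ G.branch v a) (g : G ≃g G)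
    (hg : g x = x) : g v = v := by
  have sep : ∀ y, y ∉ G.branch v a → G.dist x y = G.dist x a + 1 + G.dist v y := by
    intro y hy
    rw [G.dist_comm (u := x), hT.dist_of_mem_branch ha hy hx, G.dist_comm (u := y),
      G.dist_comm (u := a)]
    omega
  have hxg : ∀ y, G.dist x (g y) = G.dist x y := by
    intro y
    conv_lhs => rw [← hg]
    exact g.dist_apply x y
  have hv := sep v notMem_branch
  rw [dist_self] at hv
  by_cases hgv : g v ∈ G.branch v a
  · obtain ⟨y, hy, hgy⟩ : ∃ y, y ∉ G.branch v a ∧ g y ∉ G.branch v a := by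
      by_contra! hcon
      have h1 : g '' (insert v (G.branch v b)) ⊆ G.branch v a := by
        rintro _ ⟨y, hy, rfl⟩
        rcases hy with rfl | hy
        · exact hgv
        · exact hcon y fun hya ↦ hab (hT.eq_of_mem_branch_of_mem_branch ha hb hya hy)
      have h2 := Set.ncard_le_ncard h1
      rw [Set.ncard_image_of_injective _ g.injective, Set.ncard_insert_of_notMem notMem_branch] at h2
      omega
    have h1 := sep y hy
    have h2 := sep (g y) hgy
    have h3 := hT.dist_of_mem_branch ha hgy hgv
    have h4 := hxg y
    have h5 := g.dist_apply v y
    rw [G.dist_comm (u := g v)] at h5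
    rw [G.dist_comm (u := g y) (v := v)] at h3
    omega
  · have h1 := sep _ hgv
    have h2 := hxg v
    exact (hT.connected.dist_eq_zero_iff.mp (by omega)).symm

open Classical in
/-- The automorphism that exchanges the branch at `v` through `a` with its image under an
automorphism `f` that fixes `v` and moves `a`, and that fixes every other vertex. -/
noncomputable def branchSwap (f : G ≃g G) {v a : V} (hv : f v = v) (ha : G.Adj v a)
    (hne : f a ≠ a) : G ≃g G :=
  have hb : G.Adj v (f a) := by simpa [hv] using f.map_adj_iff.mpr ha
  have hdisj : ∀ x, x ∈ G.branch v a → x ∉ G.branch v (f a) := fun _ h1 h2 ↦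
    hne (hT.eq_of_mem_branch_of_mem_branch ha hb h1 h2).symm
  let σ : V → V := fun x ↦
    if x ∈ G.branch v a then f x else if x ∈ G.branch v (f a) then f.symm x else x
  have hσ1 : ∀ x, x ∈ G.branch v a → σ x = f x := fun x hx ↦ if_pos hx
  have hσ2 : ∀ x, x ∈ G.branch v (f a) → σ x = f.symm x := fun x hx ↦ by
    have : x ∉ G.branch v a := fun h ↦ hdisj x h hx
    simp [σ, this, hx]
  have hσ3 : ∀ x, x ∉ G.branch v a → x ∉ G.branch v (f a) → σ x = x := fun x h1 h2 ↦ by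
    simp [σ, h1, h2]
  have hf1 : ∀ x, f x ∈ G.branch v (f a) ↔ x ∈ G.branch v a :=
    fun _ ↦ f.apply_mem_branch_of_fixed hv
  have hf2 : ∀ x, f.symm x ∈ G.branch v a ↔ x ∈ G.branch v (f a) := fun x ↦ by
    rw [← hf1]; simp
  have hinv : Function.Involutive σ := fun x ↦ by
    by_cases h1 : x ∈ G.branch v a
    · rw [hσ1 x h1, hσ2 _ ((hf1 x).mpr h1)]; simp
    · by_cases h2 : x ∈ G.branch v (f a)
      · rw [hσ2 x h2, hσ1 _ ((hf2 x).mpr h2)]; simp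
      · rw [hσ3 x h1 h2, hσ3 x h1 h2]
  have hσv : σ v = v := hσ3 v notMem_branch notMem_branch
  have hadj : ∀ x y, G.Adj x y → G.Adj (σ x) (σ y) := by
    have hA : ∀ x y, G.Adj x y → x ∈ G.branch v a → G.Adj (σ x) (σ y) := by
      intro x y h hx
      by_cases hy : y ∈ G.branch v a
      · rw [hσ1 x hx, hσ1 y hy]; exact f.map_adj_iff.mpr h
      · obtain ⟨rfl, rfl⟩ := hT.eq_of_adj_of_mem_branch ha h hx hy
        rw [hσv, hσ1 _ hx]; exact hb.symm
    have hB : ∀ x y, G.Adj x y → x ∈ G.branch v (f a) → G.Adj (σ x) (σ y) := by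
      intro x y h hx
      by_cases hy : y ∈ G.branch v (f a)
      · rw [hσ2 x hx, hσ2 y hy]; exact f.symm.map_adj_iff.mpr h
      · obtain ⟨rfl, rfl⟩ := hT.eq_of_adj_of_mem_branch hb h hx hy
        rw [hσv, hσ2 _ hx]; simpa using ha.symm
    intro x y h
    by_cases hx1 : x ∈ G.branch v a
    · exact hA x y h hx1
    by_cases hx2 : x ∈ G.branch v (f a)
    · exact hB x y h hx2
    by_cases hy1 : y ∈ G.branch v a
    · exact (hA y x h.symm hy1).symm
    by_cases hy2 : y ∈ G.branch v (f a)
    · exact (hB y x h.symm hy2).symm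
    rwa [hσ3 x hx1 hx2, hσ3 y hy1 hy2]
  { toEquiv := hinv.toPerm
    map_rel_iff' := fun {x y} ↦
      ⟨fun h ↦ by simpa [hinv x, hinv y] using hadj _ _ h, fun h ↦ hadj x y h⟩ }

section branchSwap

variable {f : G ≃g G} {v a : V} (hv : f v = v) (ha : G.Adj v a) (hne : f a ≠ a)

lemma branchSwap_apply_of_mem {x : V} (hx : x ∈ G.branch v a) :
    hT.branchSwap f hv ha hne x = f x := if_pos hx

lemma branchSwap_apply_apply_of_mem {x : V} (hx : x ∈ G.branch v a) :
    hT.branchSwap f hv ha hne (f x) = x := by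
  have hb : G.Adj v (f a) := by simpa [hv] using f.map_adj_iff.mpr ha
  have h1 : f x ∈ G.branch v (f a) := (f.apply_mem_branch_of_fixed hv).mpr hx
  have h2 : f x ∉ G.branch v a := fun h ↦
    hne (hT.eq_of_mem_branch_of_mem_branch ha hb h h1).symm
  exact (if_neg h2).trans ((if_pos h1).trans (f.symm_apply_apply x))

lemma branchSwap_apply_of_notMem {x : V} (h1 : x ∉ G.branch v a) (h2 : x ∉ G.branch v (f a)) :
    hT.branchSwap f hv ha hne x = x := (if_neg h1).trans (if_neg h2)

end branchSwap

/-- A nontrivial automorphism of a finite tree that preserves the bipartition yields an automorphism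
`f` fixing a vertex `v` and moving a neighbor `a` of `v`. Choosing the branch at `v` through `a` of
least size, that branch becomes rigid: only the identity on it fixes `v` and `a`. -/
lemma exists_rigid_branch [Finite V] (f₀ : G ≃g G) (hf₀ : f₀ ≠ Iso.refl)
    (heven : ∀ x, Even (G.dist x (f₀ x))) :
    ∃ (f : G ≃g G) (v a : V), f v = v ∧ G.Adj v a ∧ f a ≠ a ∧
      ∀ g : G ≃g G, g v = v → g a = a → ∀ x ∈ G.branch v a, g x = x := by
  classical
  -- A moved vertex nearest to a fixed vertex `r` is adjacent to a fixed vertex on the way to `r`.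
  have nearest : ∀ (f : G ≃g G) (r : V) (s : Set V), f r = r → (∃ x ∈ s, f x ≠ x) →
      ∃ u x, x ∈ s ∧ G.Adj x u ∧ f x ≠ x ∧ G.dist u r + 1 = G.dist x r ∧ (u ∈ s → f u = u) := by
    intro f r s hr hx
    obtain ⟨x, ⟨hxs, hx⟩, hmin⟩ := Set.exists_min_image {x | x ∈ s ∧ f x ≠ x} (G.dist · r)
      (Set.toFinite _) hx
    obtain ⟨u, hxu, hu⟩ := hT.connected.exists_adj_dist_add_one (u := x) (w := r)
      (fun h ↦ hx (h ▸ hr))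
    refine ⟨u, x, hxs, hxu, hx, hu, fun hus ↦ ?_⟩
    by_contra hfu
    have := hmin u ⟨hus, hfu⟩
    omega
  let Q : ℕ → Prop := fun n ↦ ∃ (f : G ≃g G) (v a : V),
    f v = v ∧ G.Adj v a ∧ f a ≠ a ∧ (G.branch v a).ncard = n
  have hQ : ∃ n, Q n := by
    obtain ⟨r, hr⟩ := hT.exists_fixed_vertex f₀ heven
    obtain ⟨x, hx⟩ : ∃ x, f₀ x ≠ x := by
      by_contra! h
      exact hf₀ (RelIso.ext h)
    obtain ⟨u, y, -, hyu, hy, -, hu⟩ := nearest f₀ r Set.univ hr ⟨x, trivial, hx⟩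
    exact ⟨_, f₀, u, y, hu trivial, hyu.symm, hy, rfl⟩
  obtain ⟨f, v, a, hv, ha, hne, hcard⟩ := Nat.find_spec hQ
  refine ⟨f, v, a, hv, ha, hne, fun g hgv hga x hx ↦ ?_⟩
  by_contra hgx
  obtain ⟨u, y, hy, hyu, hgy, hd, hu⟩ := nearest g v (G.branch v a) hgv ⟨x, hx, hgx⟩
  have hus : u ∈ G.branch v a := by
    by_contra hus
    exact hgy ((hT.eq_of_adj_of_mem_branch ha hyu hy hus).1 ▸ hga)
  have hsub : G.branch u y ⊂ G.branch v a := by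
    refine ⟨hT.branch_subset_branch hus hyu.symm ?_, fun h ↦ notMem_branch (h hus)⟩
    rw [G.dist_comm (u := v), G.dist_comm (u := v)]
    omega
  exact Nat.find_min hQ (hcard ▸ Set.ncard_lt_ncard hsub) ⟨g, u, y, hu hus, hyu.symm, hgy, rfl⟩

end IsTree

/-! ### Distinguishing colorings as functions -/

/-- A coloring is distinguishing if no automorphism other than the identity preserves the color
of every vertex. -/
def Coloring.IsDistinguishing {α : Type*} (C : G.Coloring α) : Prop :=
  ∀ f : G ≃g G, (∀ x, C (f x) = C x) → f = Iso.refl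

namespace Coloring

variable {α : Type*} (C : G.Coloring α)

lemma IsDistinguishing.toPartition {C : G.Coloring α} (hC : C.IsDistinguishing) :
    C.toPartition.IsDistinguishing := by
  refine fun f hf ↦ hC f fun x ↦ ?_
  have h := hf (C.colorClass (C x)) C.mem_colorClasses
  have h2 : f x ∈ C.colorClass (C x) := h ▸ Set.mem_image_of_mem f (C.mem_colorClass x)
  exact h2

lemma encard_colorClasses_le : C.colorClasses.encard ≤ (Set.range C).encard := by
  have : C.colorClasses ⊆ C.colorClass '' Set.range C := by
    rintro _ ⟨x, rfl⟩
    exact ⟨C x, ⟨x, rfl⟩, rfl⟩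
  exact (Set.encard_le_encard this).trans (Set.encard_image_le _ _)

end Coloring

lemma distinguishingChromaticNumber_le_encard_range {α : Type*} {C : G.Coloring α}
    (hC : C.IsDistinguishing) : G.distinguishingChromaticNumber ≤ (Set.range C).encard :=
  (iInf₂_le C.toPartition hC.toPartition).trans C.encard_colorClasses_le

lemma Partition.IsDistinguishing.toColoring' {P : G.Partition} (hP : P.IsDistinguishing) :
    P.toColoring'.IsDistinguishing := by
  intro f hf
  have huniq : ∀ x, ∀ s ∈ P.parts, x ∈ s → s = P.partOfVertex x := fun x s hs hx ↦
    (P.isPartition.2 x).unique ⟨hs, hx⟩ ⟨P.partOfVertex_mem x, P.mem_partOfVertex x⟩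
  have hf' : ∀ x, P.partOfVertex (f x) = P.partOfVertex x := hf
  refine hP f fun s hs ↦ Set.Subset.antisymm ?_ fun x hx ↦ ?_
  · rintro _ ⟨x, hx, rfl⟩
    rw [huniq x s hs hx, ← hf' x]
    exact P.mem_partOfVertex _
  · refine ⟨f.symm x, ?_, f.apply_symm_apply x⟩
    have h := hf' (f.symm x)
    rw [f.apply_symm_apply] at h
    rw [huniq x s hs hx, h]
    exact P.mem_partOfVertex _

/-- In a uniquely distinguishing colorable graph some distinguishing coloring induces the same
partition as every distinguishing coloring that uses no further colors. -/
lemma IsUniquelyDistinguishingColorable.exists_coloring (h : G.IsUniquelyDistinguishingColorable) :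
    ∃ C : G.Coloring (Set V), C.IsDistinguishing ∧
      ∀ C' : G.Coloring (Set V), C'.IsDistinguishing → Set.range C' ⊆ Set.range C →
        ∀ x y, C' x = C' y ↔ C x = C y := by
  obtain ⟨P, ⟨hP, hcard⟩, huniq⟩ := h
  refine ⟨P.toColoring', hP.toColoring', fun C' hC' hr ↦ ?_⟩
  have hker : ∀ C : G.Coloring (Set V), C.IsDistinguishing →
      Set.range C ⊆ Set.range P.toColoring' → C.toPartition = P := by
    intro C hC hr
    refine huniq _ ⟨hC.toPartition, le_antisymm ?_ (iInf₂_le C.toPartition hC.toPartition)⟩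
    rw [← hcard]
    refine C.encard_colorClasses_le.trans (Set.encard_le_encard (hr.trans ?_))
    rintro _ ⟨x, rfl⟩
    exact P.partOfVertex_mem x
  have h1 : C'.colorClasses = P.toColoring'.colorClasses :=
    congrArg Partition.parts ((hker C' hC' hr).trans (hker _ hP.toColoring' subset_rfl).symm)
  have h2 := Setoid.classes_inj.mpr h1
  exact fun x y ↦ Setoid.ext_iff.mp h2 x y

/-- The bipartition of a tree is not distinguishing if every distinguishing coloring has at least
three classes. -/
lemma IsTree.exists_iso_ne_refl_even_dist (hT : G.IsTree)
    (hχ : 3 ≤ G.distinguishingChromaticNumber) :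
    ∃ f : G ≃g G, f ≠ Iso.refl ∧ ∀ x, Even (G.dist x (f x)) := by
  obtain ⟨r⟩ := hT.connected.nonempty
  let C : G.Coloring Bool := Coloring.mk (fun x ↦ decide (Even (G.dist r x))) fun {x y} h heq ↦ by
    rcases hT.dist_eq_dist_add_one_of_adj r h with h | h <;>
      simp only [h, Nat.even_add_one, decide_eq_decide] at heq <;> tauto
  have hC : ¬ C.IsDistinguishing := fun hC ↦ by
    have h1 := hχ.trans (distinguishingChromaticNumber_le_encard_range hC)
    have h2 : (Set.range C).encard ≤ 2 := by
      refine (Set.encard_le_encard (Set.subset_univ _)).trans ?_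
      rw [Set.encard_univ]
      simp
    exact absurd (h1.trans h2) (by decide)
  simp only [Coloring.IsDistinguishing, not_forall] at hC
  obtain ⟨f, hf, hne⟩ := hC
  refine ⟨f, hne, fun x ↦ ?_⟩
  have hfx : Even (G.dist r (f x)) ↔ Even (G.dist r x) := by
    simpa [C, Coloring.mk] using hf x
  have parity : ∀ n x y, G.dist x y = n →
      (Even n ↔ (Even (G.dist r x) ↔ Even (G.dist r y))) := by
    intro n
    induction n with
    | zero =>
      intro x y h
      simp [hT.connected.dist_eq_zero_iff.mp h]
    | succ n ih =>
      intro x y h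
      obtain ⟨z, hxz, hz⟩ := hT.connected.exists_adj_dist_add_one (u := x) (w := y)
        (fun hxy ↦ by simp [hxy] at h)
      have := ih z y (by omega)
      rcases hT.dist_eq_dist_add_one_of_adj r hxz with h' | h' <;>
        rw [Nat.even_add_one, this, h', Nat.even_add_one] <;> tauto
  exact (parity _ x (f x) rfl).mpr hfx.symm

/-! ### Recoloring a pair of isomorphic branches -/

section recolor

variable {α : Type*} {C : G.Coloring α} {v a b x : V} {i j : α}

open Classical in
/-- The function that agrees with the coloring `C` outside the branches at `v` through `a` and `b`,
and that on these branches colors the vertex `x` with `i` and the other vertices alternately with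
`j` and with the color of `v`. -/
noncomputable def recolorBranches (C : G.Coloring α) (v a b x : V) (i j : α) (y : V) : α :=
  if y = x then i else if y ∈ G.branch v a ∨ y ∈ G.branch v b then
    (if Even (G.dist v y) then C v else j) else C y

lemma recolorBranches_of_notMem (hx : x ∈ G.branch v a) {y : V} (h1 : y ∉ G.branch v a)
    (h2 : y ∉ G.branch v b) : recolorBranches C v a b x i j y = C y := by
  have : y ≠ x := fun h ↦ h1 (h ▸ hx)
  simp [recolorBranches, this, h1, h2]

lemma recolorBranches_of_adj (ha : G.Adj v a) (hb : G.Adj v b) {y : V} (hyx : y ≠ x)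
    (hy : y = a ∨ y = b) : recolorBranches C v a b x i j y = j := by
  rcases hy with rfl | rfl
  · simp [recolorBranches, hyx, self_mem_branch ha, dist_eq_one_iff_adj.mpr ha]
  · simp [recolorBranches, hyx, self_mem_branch hb, dist_eq_one_iff_adj.mpr hb]

lemma recolorBranches_eq_left_iff (hij : i ≠ j)
    (hi : ∀ y, y ∉ G.branch v a → y ∉ G.branch v b → C y ≠ i) {y : V} :
    recolorBranches C v a b x i j y = i ↔ y = x := by
  refine ⟨fun h ↦ ?_, fun h ↦ by simp [recolorBranches, h]⟩
  by_contra hyx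
  have hvi : C v ≠ i := hi v notMem_branch notMem_branch
  by_cases hy : y ∈ G.branch v a ∨ y ∈ G.branch v b
  · simp only [recolorBranches, hyx, hy, if_true, if_false] at h
    split_ifs at h
    · exact hvi h
    · exact hij h.symm
  · simp only [recolorBranches, hyx, hy, if_false] at h
    rw [not_or] at hy
    exact hi y hy.1 hy.2 h

lemma range_recolorBranches_subset (hi : i ∈ Set.range C) (hj : j ∈ Set.range C) :
    Set.range (recolorBranches C v a b x i j) ⊆ Set.range C := by
  rintro _ ⟨y, rfl⟩
  unfold recolorBranches
  split_ifs <;> simp_all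

end recolor

namespace IsTree

variable (hT : G.IsTree)
include hT

/-- If all distinguishing colorings with the colors of `C` induce the same partition, then the
exchange of a branch with its isomorphic copy permutes the classes of `C`. As it moves some class,
there are two classes that lie within these two branches. -/
lemma exists_colors_in_branches {α : Type*} {C : G.Coloring α} (hC : C.IsDistinguishing)
    (huniq : ∀ C' : G.Coloring α, C'.IsDistinguishing → Set.range C' ⊆ Set.range C →
      ∀ x y, C' x = C' y ↔ C x = C y)
    {f : G ≃g G} {v a : V} (hv : f v = v) (ha : G.Adj v a) (hne : f a ≠ a) :
    ∃ x ∈ G.branch v a, C (f x) ≠ C x ∧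
      ∀ y, y ∉ G.branch v a → y ∉ G.branch v (f a) → C y ≠ C x ∧ C y ≠ C (f x) := by
  set σ := hT.branchSwap f hv ha hne
  have hσ := fun {x} hx ↦ hT.branchSwap_apply_of_mem hv ha hne (x := x) hx
  have hσ' := fun {x} hx ↦ hT.branchSwap_apply_apply_of_mem hv ha hne (x := x) hx
  have hσ'' := fun {x} hx ↦ hT.branchSwap_apply_of_notMem hv ha hne (x := x) hx
  let C' : G.Coloring α := Coloring.mk (fun x ↦ C (σ x)) fun h ↦ C.valid (σ.map_adj_iff.mpr h)
  have hC' : C'.IsDistinguishing := by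
    intro g hg
    have h1 := hC ((σ.symm.trans g).trans σ) fun x ↦ by
      have := hg (σ.symm x)
      change C (σ (g (σ.symm x))) = C (σ (σ.symm x)) at this
      rwa [σ.apply_symm_apply] at this
    refine RelIso.ext fun x ↦ σ.injective ?_
    have h2 := RelIso.ext_iff.mp h1 (σ x)
    simpa using h2
  have hker : ∀ x y, C (σ x) = C (σ y) ↔ C x = C y := huniq C' hC' (by
    rintro _ ⟨x, rfl⟩
    exact ⟨σ x, rfl⟩)
  obtain ⟨x, hx, hxc⟩ : ∃ x ∈ G.branch v a, C (f x) ≠ C x := by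
    by_contra! hcon
    refine hne ?_
    have h1 := hC σ fun x ↦ by
      by_cases h1 : x ∈ G.branch v a
      · rw [hσ h1, hcon x h1]
      · by_cases h2 : x ∈ G.branch v (f a)
        · obtain ⟨x, rfl⟩ := f.surjective x
          have h2 := (f.apply_mem_branch_of_fixed hv).mp h2
          rw [hσ' h2, hcon x h2]
        · rw [hσ'' h1 h2]
    rw [← hσ (self_mem_branch ha)]
    exact RelIso.ext_iff.mp h1 a
  refine ⟨x, hx, hxc, fun y hy1 hy2 ↦ ⟨fun h ↦ hxc ?_, fun h ↦ hxc ?_⟩⟩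
  · have := (hker y x).mpr h
    rw [hσ'' hy1 hy2, hσ hx] at this
    rw [← this, h]
  · have := (hker y (f x)).mpr h
    rw [hσ'' hy1 hy2, hσ' hx] at this
    rw [← this, h]

section recolor

variable {α : Type*} {C : G.Coloring α} {v a b x : V} {i j : α}

lemma recolorBranches_valid (ha : G.Adj v a) (hb : G.Adj v b) (hx : x ∈ G.branch v a) (hij : i ≠ j)
    (hi : ∀ y, y ∉ G.branch v a → y ∉ G.branch v b → C y ≠ i)
    (hj : ∀ y, y ∉ G.branch v a → y ∉ G.branch v b → C y ≠ j) {y z : V} (h : G.Adj y z) :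
    recolorBranches C v a b x i j y ≠ recolorBranches C v a b x i j z := by
  have hvi : C v ≠ i := hi v notMem_branch notMem_branch
  have hvj : C v ≠ j := hj v notMem_branch notMem_branch
  have hmix : ∀ y z, G.Adj y z → (y ∈ G.branch v a ∨ y ∈ G.branch v b) →
      ¬ (z ∈ G.branch v a ∨ z ∈ G.branch v b) →
      recolorBranches C v a b x i j y ≠ recolorBranches C v a b x i j z := fun y z h hy hz ↦ by
    have hzv : z = v ∧ (y = a ∨ y = b) := by
      rw [not_or] at hz
      rcases hy with hy | hy
      · have := hT.eq_of_adj_of_mem_branch ha h hy hz.1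
        exact ⟨this.2, Or.inl this.1⟩
      · have := hT.eq_of_adj_of_mem_branch hb h hy hz.2
        exact ⟨this.2, Or.inr this.1⟩
    rw [hzv.1, recolorBranches_of_notMem hx notMem_branch notMem_branch]
    by_cases hyx : y = x
    · rw [(recolorBranches_eq_left_iff hij hi).mpr hyx]
      exact hvi.symm
    · rw [recolorBranches_of_adj ha hb hyx hzv.2]
      exact hvj.symm
  by_cases hy : y ∈ G.branch v a ∨ y ∈ G.branch v b
  · by_cases hz : z ∈ G.branch v a ∨ z ∈ G.branch v b
    · have hyz := h.ne
      have hpar : Even (G.dist v y) ↔ ¬ Even (G.dist v z) := by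
        rcases hT.dist_eq_dist_add_one_of_adj v h with hd | hd <;> simp [hd, Nat.even_add_one]
      simp only [recolorBranches, hy, hz, if_true, hpar]
      split_ifs <;> simp_all [eq_comm]
    · exact hmix y z h hy hz
  · by_cases hz : z ∈ G.branch v a ∨ z ∈ G.branch v b
    · exact (hmix z y h.symm hz hy).symm
    · rw [not_or] at hy hz
      rw [recolorBranches_of_notMem hx hy.1 hy.2, recolorBranches_of_notMem hx hz.1 hz.2]
      exact C.valid h

/-- An automorphism preserving the recoloring fixes the only vertex `x` of color `i`, hence `v`,
hence `a`. It fixes `b` because no vertex outside the two branches has color `j`. By rigidity it is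
the identity on both branches, so it preserves `C` as well. -/
lemma eq_refl_of_recolorBranches [Finite V] (hC : C.IsDistinguishing) {f : G ≃g G}
    (hv : f v = v) (ha : G.Adj v a) (hne : f a ≠ a)
    (hrigid : ∀ g : G ≃g G, g v = v → g a = a → ∀ x ∈ G.branch v a, g x = x)
    (hx : x ∈ G.branch v a) (hij : i ≠ j)
    (hi : ∀ y, y ∉ G.branch v a → y ∉ G.branch v (f a) → C y ≠ i)
    (hj : ∀ y, y ∉ G.branch v a → y ∉ G.branch v (f a) → C y ≠ j) (g : G ≃g G)
    (hg : ∀ y, recolorBranches C v a (f a) x i j (g y) = recolorBranches C v a (f a) x i j y) :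
    g = Iso.refl := by
  have hb : G.Adj v (f a) := by simpa [hv] using f.map_adj_iff.mpr ha
  have hfmem : ∀ y, f y ∈ G.branch v (f a) ↔ y ∈ G.branch v a := fun _ ↦
    f.apply_mem_branch_of_fixed hv
  have hgx : g x = x := by
    rw [← recolorBranches_eq_left_iff (C := C) (x := x) hij hi, hg]
    exact (recolorBranches_eq_left_iff hij hi).mpr rfl
  have hcard : (G.branch v (f a)).ncard = (G.branch v a).ncard := by
    rw [← Set.ncard_image_of_injective (G.branch v a) f.injective]
    congr 1
    ext y
    obtain ⟨y, rfl⟩ := f.surjective y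
    rw [hfmem, f.injective.mem_set_image]
  have hgv : g v = v := hT.apply_eq_of_branch ha hb hne.symm hcard hx g hgx
  have hadj : ∀ y, G.Adj v y → G.Adj v (g y) := fun y h ↦ by
    simpa [hgv] using g.map_adj_iff.mpr h
  have hga : g a = a := by
    have h := (g.apply_mem_branch_of_fixed hgv).mpr hx
    rw [hgx] at h
    exact (hT.eq_of_mem_branch_of_mem_branch ha (hadj a ha) hx h).symm
  have hgb : g (f a) = f a := by
    have hbx : f a ≠ x := fun h ↦
      hne (hT.eq_of_mem_branch_of_mem_branch ha hb hx (h ▸ self_mem_branch hb)).symm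
    have h1 := hg (f a)
    rw [recolorBranches_of_adj ha hb hbx (Or.inr rfl)] at h1
    by_cases h2 : g (f a) ∈ G.branch v a
    · have h3 := (hT.eq_of_adj_of_mem_branch ha (hadj _ hb).symm h2 notMem_branch).1
      exact absurd (g.injective (h3.trans hga.symm)) hne
    by_cases h3 : g (f a) ∈ G.branch v (f a)
    · exact (hT.eq_of_adj_of_mem_branch hb (hadj _ hb).symm h3 notMem_branch).1
    · rw [recolorBranches_of_notMem hx h2 h3] at h1
      exact absurd h1 (hj _ h2 h3)
  have hA := hrigid g hgv hga
  have hB : ∀ y ∈ G.branch v (f a), g y = y := by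
    intro y hy
    obtain ⟨y, rfl⟩ := f.surjective y
    -- The conjugate of `g` by `f` fixes `v` and `a`.
    have h1 := hrigid ((f.trans g).trans f.symm)
      (by change f.symm (g (f v)) = v; rw [hv, hgv, ← hv, f.symm_apply_apply, hv])
      (by change f.symm (g (f a)) = a; rw [hgb, f.symm_apply_apply]) y ((hfmem y).mp hy)
    change f.symm (g (f y)) = y at h1
    rw [← f.apply_symm_apply (g (f y)), h1]
  refine hC g fun y ↦ ?_
  by_cases h1 : y ∈ G.branch v a
  · rw [hA y h1]
  by_cases h2 : y ∈ G.branch v (f a)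
  · rw [hB y h2]
  have h3 : g y ∉ G.branch v a := fun h ↦ h1 (g.injective (hA _ h) ▸ h)
  have h4 : g y ∉ G.branch v (f a) := fun h ↦ h2 (g.injective (hB _ h) ▸ h)
  have h5 := hg y
  rwa [recolorBranches_of_notMem hx h3 h4, recolorBranches_of_notMem hx h1 h2] at h5

end recolor

/-- Under uniqueness, a rigid branch that is exchanged with another one is a single leaf: moving the
color `i` from the root `a` of the branch to another vertex of it would change the partition. -/
lemma branch_eq_singleton [Finite V] {α : Type*} {C : G.Coloring α} (hC : C.IsDistinguishing)
    (huniq : ∀ C' : G.Coloring α, C'.IsDistinguishing → Set.range C' ⊆ Set.range C →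
      ∀ x y, C' x = C' y ↔ C x = C y)
    {f : G ≃g G} {v a : V} (hv : f v = v) (ha : G.Adj v a) (hne : f a ≠ a)
    (hrigid : ∀ g : G ≃g G, g v = v → g a = a → ∀ x ∈ G.branch v a, g x = x) :
    G.branch v a = {a} := by
  obtain ⟨z, hz, hcz, hout⟩ := hT.exists_colors_in_branches hC huniq hv ha hne
  have hb : G.Adj v (f a) := by simpa [hv] using f.map_adj_iff.mpr ha
  have hi := fun y h1 h2 ↦ (hout y h1 h2).1
  have hj := fun y h1 h2 ↦ (hout y h1 h2).2
  have key : ∀ x ∈ G.branch v a, ∀ y w,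
      recolorBranches C v a (f a) x (C z) (C (f z)) y =
        recolorBranches C v a (f a) x (C z) (C (f z)) w ↔ C y = C w := fun x hx ↦
    huniq (Coloring.mk (recolorBranches C v a (f a) x (C z) (C (f z)))
        fun h ↦ hT.recolorBranches_valid ha hb hx hcz.symm hi hj h)
      (fun g hg ↦ hT.eq_refl_of_recolorBranches hC hv ha hne hrigid hx hcz.symm hi hj g hg)
      (range_recolorBranches_subset ⟨z, rfl⟩ ⟨f z, rfl⟩)
  refine Set.Subset.antisymm (fun x hx ↦ ?_) (by simpa using self_mem_branch ha)
  by_contra hxa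
  have h1 := (key x hx a (f a)).mp (by
    have hbx : f a ≠ x := fun h ↦
      hne (hT.eq_of_mem_branch_of_mem_branch ha hb hx (h ▸ self_mem_branch hb)).symm
    rw [recolorBranches_of_adj ha hb (Ne.symm hxa) (Or.inl rfl),
      recolorBranches_of_adj ha hb hbx (Or.inr rfl)])
  have h2 := (key a (self_mem_branch ha) (f a) a).mpr h1.symm
  rw [(recolorBranches_eq_left_iff hcz.symm hi).mpr rfl,
    recolorBranches_eq_left_iff hcz.symm hi] at h2
  exact hne h2

/-- Under uniqueness, if two leaves at `v` are exchanged by an automorphism, every other vertex is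
adjacent to `v`: otherwise it could be given the color of one of the two leaves. -/
lemma adj_of_branch_eq_singleton {α : Type*} {C : G.Coloring α} (hC : C.IsDistinguishing)
    (huniq : ∀ C' : G.Coloring α, C'.IsDistinguishing → Set.range C' ⊆ Set.range C →
      ∀ x y, C' x = C' y ↔ C x = C y)
    {f : G ≃g G} {v a : V} (hv : f v = v) (ha : G.Adj v a) (hne : f a ≠ a)
    (hsing : G.branch v a = {a}) {y : V} (hyv : y ≠ v) : G.Adj v y := by
  classical
  by_contra hvy
  obtain ⟨z, hz, hcz, hout⟩ := hT.exists_colors_in_branches hC huniq hv ha hne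
  have hb : G.Adj v (f a) := by simpa [hv] using f.map_adj_iff.mpr ha
  have hsing' : G.branch v (f a) = {f a} := by
    ext w
    obtain ⟨w, rfl⟩ := f.surjective w
    rw [f.apply_mem_branch_of_fixed hv, hsing]
    simp
  rw [hsing, Set.mem_singleton_iff] at hz
  subst hz
  simp only [hsing, hsing', Set.mem_singleton_iff] at hout
  -- The color of each of the two leaves occurs only once.
  have hi : ∀ w, C w = C z → w = z := fun w h ↦ by
    by_contra hw
    by_cases hw' : w = f z
    · exact hcz (hw' ▸ h)
    · exact (hout w hw hw').1 h
  have hj : ∀ w, C w = C (f z) → w = f z := fun w h ↦ by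
    by_contra hw
    by_cases hw' : w = z
    · exact hcz (hw' ▸ h).symm
    · exact (hout w hw' hw).2 h
  have hleaf : ∀ w, G.Adj z w → w = v := fun w h ↦
    (hT.eq_of_adj_of_mem_branch ha h (self_mem_branch ha) (by simp [hsing, h.ne'])).2
  have hleaf' : ∀ w, G.Adj (f z) w → w = v := fun w h ↦
    (hT.eq_of_adj_of_mem_branch hb h (self_mem_branch hb) (by simp [hsing', h.ne'])).2
  have hyz : y ≠ z := fun h ↦ hvy (h ▸ ha)
  have hyb : y ≠ f z := fun h ↦ hvy (h ▸ hb)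
  let c := Function.update C y (C z)
  have hcy : c y = C z := Function.update_self ..
  have hcw : ∀ w, w ≠ y → c w = C w := fun w h ↦ Function.update_of_ne h ..
  have hynbr : ∀ w, G.Adj y w → c y ≠ c w := fun w h heq ↦ by
    rw [hcy, hcw w h.ne'] at heq
    exact hyv (hleaf y (hi w heq.symm ▸ h).symm)
  have hvalid : ∀ {u w}, G.Adj u w → c u ≠ c w := fun {u w} h ↦ by
    by_cases hu : u = y
    · subst hu; exact hynbr w h
    by_cases hw : w = y
    · subst hw; exact (hynbr u h.symm).symm
    rw [hcw u hu, hcw w hw]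
    exact C.valid h
  have hdist : ∀ g : G ≃g G, (∀ w, c (g w) = c w) → g = Iso.refl := by
    intro g hg
    have hgb : g (f z) = f z := by
      have h := hg (f z)
      rw [hcw _ hyb.symm] at h
      by_cases h' : g (f z) = y
      · rw [h', hcy] at h; exact absurd h.symm hcz
      · rw [hcw _ h'] at h; exact hj _ h
    have hgv : g v = v := hleaf' _ (by simpa [hgb] using g.map_adj_iff.mpr hb.symm)
    have hgz : g z = z := by
      have h := hg z
      rw [hcw _ hyz.symm] at h
      by_cases h' : g z = y
      · exact absurd (by simpa [hgv, h'] using g.map_adj_iff.mpr ha) hvy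
      · rw [hcw _ h'] at h; exact hi _ h
    have hgy : g y = y := by
      by_contra h'
      have h := hg y
      rw [hcy, hcw _ h'] at h
      exact hyz (g.injective ((hi _ h).trans hgz.symm))
    refine hC g fun w ↦ ?_
    by_cases hw : w = y
    · rw [hw, hgy]
    · have h := hg w
      rwa [hcw w hw, hcw _ fun h' ↦ hw (g.injective (h'.trans hgy.symm))] at h
  have h := huniq (Coloring.mk c hvalid) hdist (by
    rintro _ ⟨w, rfl⟩
    change c w ∈ _
    by_cases hw : w = y
    · rw [hw, hcy]; exact ⟨z, rfl⟩
    · rw [hcw w hw]; exact ⟨w, rfl⟩) y z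
  change c y = c z ↔ _ at h
  rw [hcy, hcw z hyz.symm] at h
  exact hyz (hi y (h.mp rfl))

lemma eq_starGraph {v : V} (h : ∀ y, y ≠ v → G.Adj v y) : G = starGraph v := by
  ext x y
  rw [starGraph_adj]
  refine ⟨fun hxy ↦ ⟨hxy.ne, ?_⟩, ?_⟩
  · by_contra! hcon
    refine hT.dist_ne_of_adj v hxy ?_
    rw [dist_eq_one_iff_adj.mpr (h x hcon.1), dist_eq_one_iff_adj.mpr (h y hcon.2)]
  · rintro ⟨hxy, rfl | rfl⟩
    · exact h y hxy.symm
    · exact (h x hxy).symm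

end IsTree

end SimpleGraph

theorem mainTheorem3 {V : Type*} [Finite V] (T : SimpleGraph V) (hT : T.IsTree)
    (hudc : T.IsUniquelyDistinguishingColorable)
    (hχ : 3 ≤ T.distinguishingChromaticNumber) :
    ∃ r : V, T = SimpleGraph.starGraph r := by
  obtain ⟨C, hC, huniq⟩ := hudc.exists_coloring
  obtain ⟨f₀, hf₀, heven⟩ := hT.exists_iso_ne_refl_even_dist hχ
  obtain ⟨f, v, a, hv, ha, hne, hrigid⟩ := hT.exists_rigid_branch f₀ hf₀ heven
  have hsing := hT.branch_eq_singleton hC huniq hv ha hne hrigid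
  exact ⟨v, hT.eq_starGraph fun y hy ↦
    hT.adj_of_branch_eq_singleton hC huniq hv ha hne hsing hy⟩
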